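/- Let $(X,\mathscr A,\mu)$ be a $\sigma$-finite measure space, let $\phi\colon X\to X$ and $w\colon X\to\mathbb C$ be $\mathscr A$-measurable, and let $L^2(\mu)$ be the complex $L^2$-space. For a measurable weight $u\colon X\to\mathbb C$, let $C_{\phi,u}$ be the operator in $L^2(\mu)$ with domain $\mathcal D(C_{\phi,u})=\{f\in L^2(\mu)\colon u\cdot(f\circ\phi)\in L^2(\mu)\}$ and $C_{\phi,u}f=u\cdot(f\circ\phi)$. It is well-defined if the $\mu$-a.e. class of $u\cdot (f\circ\phi)$ does not depend on the measurable representative of $f\in L^2(\mu)$; equivalently, if $\mu_u\circ\phi^{-1}\ll\mu$, where $\mathrm d\mu_u=|u|^2\,\mathrm d\mu$. Put $C_\phi=C_{\phi,\mathbf 1}$, and let $M_w$ be the multiplication operator $f\mapsto wf$ with domain $\{f\in L^2(\mu)\colon wf\in L^2(\mu)\}$. The product $M_wC_\phi$ has its natural domain $\{f\in\mathcal D(C_\phi)\colon C_\phi f\in\mathcal D(M_w)\}$. For a (not necessarily closed or densely defined) linear operator $T$ in a Hilbert space $\mathcal H$ with domain $\mathcal D(T)$, kernel $\mathcal N(T)$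 and range $\mathcal R(T)$, a reciprocal $T^\dag$ of $T$ exists when $\mathcal D(T)=\mathcal N(T)\oplus(\mathcal D(T)\cap\mathcal N(T)^\perp)$; it is the densely defined linear operator with domain $\mathcal D(T^\dag)=\mathcal R(T)\oplus\mathcal R(T)^\perp$ and kernel $\mathcal N(T^\dag)=\mathcal R(T)^\perp$ such that $TT^\dag f=P_{\overline{\mathcal R(T)}}f$ for $f\in\mathcal D(T^\dag)$ and $T^\dag Tg=P_{\mathcal N(T)^\perp}g$ for $g\in\mathcal D(T)$, where $P_{\mathcal M}$ denotes the orthogonal projection onto $\mathcal M$. Suppose that $C_\phi$ is well-defined (then so is $C_{\phi,w}$). Then $C_{\phi,w}$ has a unique reciprocal $C_{\phi,w}^\dag$, the operator $M_wC_\phi$ has a unique reciprocal $(M_wC_\phi)^\dag$, and $$(M_wC_\phi)^\dag=C_{\phi,w}^\dag|_{\mathcal R(M_wC_\phi)}\oplus 0|_{\mathcal R(M_wC_\phi)^\perp},$$ where the right-hand side has domain $\mathcal R(M_wC_\phi)\oplus\mathcal R(M_wC_\phi)^\perp$ and sends $f_1+f_2$, with $f_1\in\mathcal R(M_wC_\phi)$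 and $f_2\in\mathcal R(M_wC_\phi)^\perp$, to $C_{\phi,w}^\dag f_1$. -/

import Mathlib

open MeasureTheory
open scoped ENNReal

noncomputable section

/-! ### Unbounded operators in a Hilbert space and their reciprocals -/

namespace UnbddOp

variable {H : Type*} [NormedAddCommGroup H] [InnerProductSpace ℂ H]

/-- The kernel `N(T)` of an operator, as a subspace of the whole space. -/
def kernel (T : H →ₗ.[ℂ] H) : Submodule ℂ H :=
  (LinearMap.ker T.toFun).map T.domain.subtype

/-- The range `R(T)` of an operator. -/
def range (T : H →ₗ.[ℂ] H) : Submodule ℂ H :=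
  LinearMap.range T.toFun

/-- The product `B A` of two operators, with its natural domain
`{f ∈ D(A) : A f ∈ D(B)}`. -/
def prod (B A : H →ₗ.[ℂ] H) : H →ₗ.[ℂ] H where
  domain :=
    { carrier := {f | ∃ hf : f ∈ A.domain, A ⟨f, hf⟩ ∈ B.domain}
      add_mem' := by
        rintro f g ⟨hf, hf'⟩ ⟨hg, hg'⟩
        refine ⟨A.domain.add_mem hf hg, ?_⟩
        have h := A.map_add ⟨f, hf⟩ ⟨g, hg⟩
        rw [AddMemClass.mk_add_mk] at h
        rw [h]
        exact B.domain.add_mem hf' hg'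
      zero_mem' := by
        refine ⟨A.domain.zero_mem, ?_⟩
        have h : A ⟨0, A.domain.zero_mem⟩ = 0 := A.map_zero
        rw [h]
        exact B.domain.zero_mem
      smul_mem' := by
        rintro c f ⟨hf, hf'⟩
        refine ⟨A.domain.smul_mem c hf, ?_⟩
        have h := A.map_smul c ⟨f, hf⟩
        rw [SetLike.mk_smul_mk] at h
        rw [h]
        exact B.domain.smul_mem c hf' }
  toFun :=
    { toFun := fun f => B ⟨A ⟨f.1, f.2.1⟩, f.2.2⟩
      map_add' := by
        intro f g
        rw [← B.map_add]
        congr 1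
        apply Subtype.ext
        exact A.map_add ⟨f.1, f.2.1⟩ ⟨g.1, g.2.1⟩
      map_smul' := by
        intro c f
        rw [RingHom.id_apply, ← B.map_smul]
        congr 1
        apply Subtype.ext
        exact A.map_smul c ⟨f.1, f.2.1⟩ }

/-- For an operator `S` and a subspace `R`, the operator `S|_R ⊕ 0|_{Rᗮ}`: it sends `f₁ + f₂`,
with `f₁ ∈ R ∩ D(S)` and `f₂ ∈ Rᗮ`, to `S f₁`. -/
def restrictOplusZero (S : H →ₗ.[ℂ] H) (R : Submodule ℂ H) : H →ₗ.[ℂ] H :=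
  (S.domRestrict R).sup ((0 : H →ₗ[ℂ] H).toPMap Rᗮ)
    (LinearPMap.sup_h_of_disjoint _ _
      (R.orthogonal_disjoint.mono_left (by
        rw [LinearPMap.domRestrict_domain]
        exact inf_le_left)))

variable [CompleteSpace H]

/-- `S` is the reciprocal `T†` of `T`. -/
structure IsReciprocal (T S : H →ₗ.[ℂ] H) : Prop where
  /-- `D(T) = N(T) ⊕ (D(T) ∩ N(T)ᗮ)`, the condition under which `T` has a reciprocal. -/
  decomp : T.domain = kernel T ⊔ (T.domain ⊓ (kernel T)ᗮ)
  /-- `T†` is densely defined. -/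
  dense : Dense (S.domain : Set H)
  /-- `D(T†) = R(T) ⊕ R(T)ᗮ`. -/
  domain_eq : S.domain = range T ⊔ (range T)ᗮ
  /-- `T T† f` is the projection of `f` to the closure of `R(T)`, for `f ∈ D(T†)`. -/
  comp_left : ∀ f : S.domain, ∃ h : S f ∈ T.domain,
    T ⟨S f, h⟩ = (range T).topologicalClosure.starProjection (f : H)
  /-- `T† T g` is the projection of `g` to `N(T)ᗮ`, for `g ∈ D(T)`. -/
  comp_right : ∀ g : T.domain, ∃ h : T g ∈ S.domain,
    S ⟨T g, h⟩ = (kernel T)ᗮ.starProjection (g : H)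
  /-- `N(T†) = R(T)ᗮ`. -/
  kernel_eq : kernel S = (range T)ᗮ

end UnbddOp

/-! ### Weighted composition operators in `L²(μ)` -/

namespace WeightedComp

variable {X : Type*} [MeasurableSpace X]

/-- `f ↦ w · (f ∘ φ)` does not depend on the choice of a measurable representative of an element
of `L²(μ)`, that is, the weighted composition operator `C_{φ,w}` is well-defined. -/
def WellDefined (μ : Measure X) (φ : X → X) (w : X → ℂ) : Prop :=
  ∀ f g : X → ℂ, Measurable f → Measurable g → MemLp f 2 μ → MemLp g 2 μ → f =ᵐ[μ] g →
    (fun x => w x * f (φ x)) =ᵐ[μ] fun x => w x * g (φ x)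

/-- Well-definedness of `C_{φ,w}` is absolute continuity of `μ_w ∘ φ⁻¹` with respect to `μ`,
where `μ_w` has density `|w|²`. -/
theorem wellDefined_iff {μ : Measure X} [SigmaFinite μ] {φ : X → X} {w : X → ℂ}
    (hφ : Measurable φ) (hw : Measurable w) :
    WellDefined μ φ w ↔
      ((μ.withDensity fun x => ‖w x‖ₑ ^ 2).map φ).AbsolutelyContinuous μ := by
  have hd : Measurable fun x => ‖w x‖ₑ ^ 2 := hw.enorm.pow_const 2
  constructor
  · intro h
    refine Measure.AbsolutelyContinuous.mk fun N hN hN0 => ?_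
    rw [Measure.map_apply hφ hN, withDensity_apply _ (hφ hN),
      setLIntegral_eq_zero_iff (hφ hN) hd]
    have hz : N.indicator (1 : X → ℂ) =ᵐ[μ] (0 : X → ℂ) := by
      filter_upwards [measure_eq_zero_iff_ae_notMem.1 hN0] with x hx
      simp [hx]
    have hm : Measurable (N.indicator (1 : X → ℂ)) := measurable_one.indicator hN
    have h0 : MemLp (0 : X → ℂ) 2 μ := MemLp.zero
    have := h _ _ hm measurable_zero ((memLp_congr_ae hz).2 h0) h0 hz
    filter_upwards [this] with x hx hxN
    have hxN' : φ x ∈ N := hxN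
    simpa [hxN'] using hx
  · intro h f g hf hg _ _ hfg
    have hs : MeasurableSet {y | f y ≠ g y} := (measurableSet_eq_fun hf hg).compl
    have h0 : ((μ.withDensity fun x => ‖w x‖ₑ ^ 2).map φ) {y | f y ≠ g y} = 0 := h hfg
    rw [Measure.map_apply hφ hs, withDensity_apply _ (hφ hs),
      setLIntegral_eq_zero_iff (hφ hs) hd] at h0
    filter_upwards [h0] with x hx
    by_cases hxe : f (φ x) = g (φ x)
    · simp [hxe]
    · have : w x = 0 := by simpa using hx hxe
      simp [this]

/-- If the composition operator `C_φ = C_{φ,1}` is well-defined, so is every `C_{φ,w}`. -/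
theorem WellDefined.weight {μ : Measure X} {φ : X → X} (h : WellDefined μ φ 1) (w : X → ℂ) :
    WellDefined μ φ w := by
  intro f g hf hg hf2 hg2 hfg
  filter_upwards [h f g hf hg hf2 hg2 hfg] with x hx
  have hx' : f (φ x) = g (φ x) := by simpa using hx
  rw [hx']

theorem wellDefined_id (μ : Measure X) (w : X → ℂ) : WellDefined μ id w := by
  intro f g _ _ _ _ hfg
  filter_upwards [hfg] with x hx
  simp [hx]

theorem WellDefined.ae_add {μ : Measure X} {φ : X → X} {w : X → ℂ} (h : WellDefined μ φ w)
    (f g : Lp ℂ 2 μ) :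
    (fun x => w x * (f + g : Lp ℂ 2 μ) (φ x)) =ᵐ[μ]
      (fun x => w x * f (φ x)) + fun x => w x * g (φ x) := by
  refine (h _ (⇑f + ⇑g) (Lp.stronglyMeasurable _).measurable
    ((Lp.stronglyMeasurable f).measurable.add (Lp.stronglyMeasurable g).measurable)
    (Lp.memLp _) ((Lp.memLp f).add (Lp.memLp g)) (Lp.coeFn_add f g)).trans (ae_of_all _ fun x => ?_)
  simp [mul_add]

theorem WellDefined.ae_smul {μ : Measure X} {φ : X → X} {w : X → ℂ} (h : WellDefined μ φ w)
    (c : ℂ) (f : Lp ℂ 2 μ) :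
    (fun x => w x * (c • f : Lp ℂ 2 μ) (φ x)) =ᵐ[μ] c • fun x => w x * f (φ x) := by
  refine (h _ (c • ⇑f) (Lp.stronglyMeasurable _).measurable
    ((Lp.stronglyMeasurable f).measurable.const_smul c)
    (Lp.memLp _) ((Lp.memLp f).const_smul c) (Lp.coeFn_smul c f)).trans (ae_of_all _ fun x => ?_)
  simp [mul_left_comm]

theorem WellDefined.ae_zero {μ : Measure X} {φ : X → X} {w : X → ℂ} (h : WellDefined μ φ w) :
    (fun x => w x * (0 : Lp ℂ 2 μ) (φ x)) =ᵐ[μ] 0 := by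
  refine (h _ (0 : X → ℂ) (Lp.stronglyMeasurable _).measurable measurable_zero
    (Lp.memLp _) MemLp.zero (Lp.coeFn_zero ℂ 2 μ)).trans (ae_of_all _ fun x => ?_)
  simp

/-- The domain `D(C_{φ,w}) = {f ∈ L²(μ) : w · (f ∘ φ) ∈ L²(μ)}`. -/
def weightedCompDomain (μ : Measure X) (φ : X → X) (w : X → ℂ) (h : WellDefined μ φ w) :
    Submodule ℂ (Lp ℂ 2 μ) where
  carrier := {f | MemLp (fun x => w x * f (φ x)) 2 μ}
  add_mem' := by
    intro f g hf hg
    exact (memLp_congr_ae (h.ae_add f g)).2 (MemLp.add hf hg)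
  zero_mem' := (memLp_congr_ae h.ae_zero).2 MemLp.zero
  smul_mem' := by
    intro c f hf
    exact (memLp_congr_ae (h.ae_smul c f)).2 (MemLp.const_smul hf c)

theorem memLp_of_mem {μ : Measure X} {φ : X → X} {w : X → ℂ} {h : WellDefined μ φ w}
    {f : Lp ℂ 2 μ} (hf : f ∈ weightedCompDomain μ φ w h) :
    MemLp (fun x => w x * f (φ x)) 2 μ :=
  hf

/-- The weighted composition operator `C_{φ,w}` in `L²(μ)`:
`D(C_{φ,w}) = {f ∈ L²(μ) : w · (f ∘ φ) ∈ L²(μ)}` and `C_{φ,w} f = w · (f ∘ φ)`. -/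
def weightedCompOp (μ : Measure X) (φ : X → X) (w : X → ℂ) (h : WellDefined μ φ w) :
    Lp ℂ 2 μ →ₗ.[ℂ] Lp ℂ 2 μ where
  domain := weightedCompDomain μ φ w h
  toFun :=
    { toFun := fun f => MemLp.toLp (fun x => w x * (f : Lp ℂ 2 μ) (φ x)) (memLp_of_mem f.2)
      map_add' := by
        intro f g
        have hf := memLp_of_mem f.2
        have hg := memLp_of_mem g.2
        rw [← MemLp.toLp_add hf hg]
        exact MemLp.toLp_congr _ _ (h.ae_add f.1 g.1)
      map_smul' := by
        intro c f
        have hf := memLp_of_mem f.2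
        rw [RingHom.id_apply, ← MemLp.toLp_const_smul c hf]
        exact MemLp.toLp_congr _ _ (h.ae_smul c f.1) }

/-- The composition operator `C_φ = C_{φ,1}`. -/
def compOp (μ : Measure X) (φ : X → X) (h : WellDefined μ φ 1) : Lp ℂ 2 μ →ₗ.[ℂ] Lp ℂ 2 μ :=
  weightedCompOp μ φ 1 h

/-- The multiplication operator `M_w = C_{id,w}`:
`D(M_w) = {f ∈ L²(μ) : w · f ∈ L²(μ)}` and `M_w f = w · f`. -/
def mulOp (μ : Measure X) (w : X → ℂ) : Lp ℂ 2 μ →ₗ.[ℂ] Lp ℂ 2 μ :=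
  weightedCompOp μ id w (wellDefined_id μ w)

end WeightedComp

end

/-! ### Reciprocals of unbounded operators and of their restrictions -/

namespace UnbddOp

section

variable {H : Type*} [NormedAddCommGroup H] [InnerProductSpace ℂ H]

/-! Write `T` for `C_{φ,w}` and `P` for `M_w C_φ`, so that `P ≤ T`. If the domain of an operator
splits along its kernel, the reciprocal inverts the restriction to the orthocomplement of the kernel
and is zero on the orthocomplement of the range; this gives existence and uniqueness. The kernel of
`T` consists of the functions vanishing a.e. on the set `A` where the density of `μ_w ∘ φ⁻¹` is
nonzero. Cutting off outside `A` therefore splits `D(T)`, and it preserves `D(P)` as well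
(`exists_mem_kernel_sub_mem_orthogonal`). So a vector of `D(P)` orthogonal to `N(P)` is already
orthogonal to `N(T)`, and `T†` inverts `P` on such vectors; `IsReciprocal.restrictOplusZero` turns
this into the formula. -/

theorem mem_kernel_iff {T : H →ₗ.[ℂ] H} {f : H} :
    f ∈ kernel T ↔ ∃ h : f ∈ T.domain, T ⟨f, h⟩ = 0 := by
  simp only [kernel, Submodule.mem_map, LinearMap.mem_ker, Submodule.subtype_apply]
  constructor
  · rintro ⟨y, hy, rfl⟩
    exact ⟨y.2, hy⟩
  · rintro ⟨h, hf⟩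
    exact ⟨⟨f, h⟩, hf, rfl⟩

theorem kernel_le_domain (T : H →ₗ.[ℂ] H) : kernel T ≤ T.domain := fun _ hf =>
  (mem_kernel_iff.1 hf).1

theorem apply_mem_range (T : H →ₗ.[ℂ] H) (g : T.domain) : T g ∈ range T :=
  LinearMap.mem_range_self T.toFun g

theorem mem_range_iff {T : H →ₗ.[ℂ] H} {f : H} : f ∈ range T ↔ ∃ g : T.domain, T g = f :=
  Iff.rfl

/-- Every vector of the domain splits into a vector of the kernel and one orthogonal to it. -/
def Decomposable (T : H →ₗ.[ℂ] H) : Prop :=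
  ∀ g ∈ T.domain, ∃ n ∈ kernel T, g - n ∈ (kernel T)ᗮ

theorem decomposable_iff {T : H →ₗ.[ℂ] H} :
    Decomposable T ↔ T.domain = kernel T ⊔ (T.domain ⊓ (kernel T)ᗮ) := by
  constructor
  · intro hT
    refine le_antisymm (fun g hg => ?_) (sup_le (kernel_le_domain T) inf_le_left)
    obtain ⟨n, hn, hgn⟩ := hT g hg
    exact Submodule.mem_sup.2
      ⟨n, hn, g - n, ⟨T.domain.sub_mem hg (kernel_le_domain T hn), hgn⟩, by simp⟩
  · intro hT g hg
    rw [hT] at hg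
    obtain ⟨n, hn, g', hg', rfl⟩ := Submodule.mem_sup.1 hg
    exact ⟨n, hn, by simpa using hg'.2⟩

/-- Replacing a vector of the domain by its part orthogonal to the kernel. -/
theorem Decomposable.exists_orthogonal [CompleteSpace H] {T : H →ₗ.[ℂ] H} (hT : Decomposable T)
    (g : T.domain) :
    ∃ g' : T.domain, (g' : H) ∈ (kernel T)ᗮ ∧ T g' = T g ∧
      (kernel T)ᗮ.starProjection (g : H) = g' := by
  obtain ⟨n, hn, hgn⟩ := hT g g.2
  obtain ⟨hnd, hTn⟩ := mem_kernel_iff.1 hn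
  refine ⟨g - ⟨n, hnd⟩, hgn, by rw [T.map_sub, hTn, sub_zero], ?_⟩
  exact Submodule.eq_starProjection_of_mem_orthogonal hgn
    (by simpa using Submodule.le_orthogonal_orthogonal _ hn)

theorem dense_sup_orthogonal [CompleteSpace H] (R : Submodule ℂ H) :
    Dense ((R ⊔ Rᗮ : Submodule ℂ H) : Set H) := by
  rw [Submodule.dense_iff_topologicalClosure_eq_top, Submodule.topologicalClosure_eq_top_iff,
    ← Submodule.inf_orthogonal]
  exact Rᗮ.inf_orthogonal_eq_bot

theorem topologicalClosure_starProjection_add [CompleteSpace H] {R : Submodule ℂ H} {f₁ f₂ : H}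
    (h₁ : f₁ ∈ R) (h₂ : f₂ ∈ Rᗮ) : R.topologicalClosure.starProjection (f₁ + f₂) = f₁ :=
  Submodule.eq_starProjection_of_mem_orthogonal (R.le_topologicalClosure h₁)
    (by simpa [Submodule.orthogonal_closure] using h₂)

/-- By linearity `S` is fixed by its values on `R(T)` and on its orthocomplement, and by the
splitting every vector of `R(T)` has a preimage orthogonal to `N(T)`. -/
theorem isReciprocal_of_decomposable [CompleteSpace H] {T S : H →ₗ.[ℂ] H} (hT : Decomposable T)
    (hdom : S.domain = range T ⊔ (range T)ᗮ)
    (hinv : ∀ g : T.domain, (g : H) ∈ (kernel T)ᗮ → ∃ h : T g ∈ S.domain, S ⟨T g, h⟩ = g)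
    (hzero : ∀ f ∈ (range T)ᗮ, ∃ h : f ∈ S.domain, S ⟨f, h⟩ = 0) : IsReciprocal T S := by
  have key : ∀ f : S.domain, ∃ g : T.domain, (g : H) ∈ (kernel T)ᗮ ∧ S f = g ∧
      ∃ f₂ ∈ (range T)ᗮ, T g + f₂ = f := by
    rintro ⟨f, hf⟩
    have hf' := hf
    rw [hdom] at hf'
    obtain ⟨f₁, h₁, f₂, h₂, rfl⟩ := Submodule.mem_sup.1 hf'
    obtain ⟨g₀, rfl⟩ := mem_range_iff.1 h₁
    obtain ⟨g, hg, hTg, -⟩ := hT.exists_orthogonal g₀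
    obtain ⟨hd, hS⟩ := hinv g hg
    obtain ⟨hd₂, hS₂⟩ := hzero f₂ h₂
    refine ⟨g, hg, ?_, f₂, h₂, by rw [hTg]⟩
    simp only [← hTg]
    have := S.map_add ⟨T g, hd⟩ ⟨f₂, hd₂⟩
    rw [AddMemClass.mk_add_mk, hS, hS₂, add_zero] at this
    exact this
  refine ⟨decomposable_iff.1 hT, ?_, hdom, fun f => ?_, fun g => ?_, le_antisymm ?_ ?_⟩
  · rw [hdom]
    exact dense_sup_orthogonal _
  · obtain ⟨g, -, hS, f₂, h₂, hf⟩ := key f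
    rw [← hf, topologicalClosure_starProjection_add (apply_mem_range T g) h₂]
    refine ⟨hS ▸ g.2, ?_⟩
    congr 1
    exact Subtype.ext hS
  · obtain ⟨g', hg', hTg, hP⟩ := hT.exists_orthogonal g
    rw [hP, ← hTg]
    exact hinv g' hg'
  · intro f hf
    obtain ⟨hfd, hSf⟩ := mem_kernel_iff.1 hf
    obtain ⟨g, -, hS, f₂, h₂, hfg⟩ := key ⟨f, hfd⟩
    have hg : g = 0 := Subtype.ext (hS.symm.trans hSf)
    rw [hg, T.map_zero, zero_add] at hfg
    rwa [← show f₂ = f from hfg]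
  · intro f hf
    exact mem_kernel_iff.2 (hzero f hf)

namespace IsReciprocal

variable [CompleteSpace H] {T S S' : H →ₗ.[ℂ] H}

theorem decomposable (h : IsReciprocal T S) : Decomposable T :=
  decomposable_iff.2 h.decomp

theorem apply_of_orthogonal (h : IsReciprocal T S) (g : T.domain) (hg : (g : H) ∈ (kernel T)ᗮ) :
    ∃ hd : T g ∈ S.domain, S ⟨T g, hd⟩ = g := by
  obtain ⟨hd, hS⟩ := h.comp_right g
  exact ⟨hd, hS.trans (Submodule.starProjection_eq_self_iff.2 hg)⟩

/-- `comp_right` determines a reciprocal on `R(T)`, and `kernel_eq` on its orthocomplement. -/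
theorem le (h : IsReciprocal T S) (h' : IsReciprocal T S') : S ≤ S' := by
  refine ⟨(h.domain_eq.trans h'.domain_eq.symm).le, ?_⟩
  rintro ⟨f, hf⟩ ⟨f', hf'⟩ (rfl : f = f')
  have hf₀ := hf
  rw [h.domain_eq] at hf₀
  obtain ⟨f₁, h₁, f₂, h₂, rfl⟩ := Submodule.mem_sup.1 hf₀
  obtain ⟨g, rfl⟩ := mem_range_iff.1 h₁
  obtain ⟨d, e⟩ := h.comp_right g
  obtain ⟨d', e'⟩ := h'.comp_right g
  rw [← h.kernel_eq] at h₂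
  obtain ⟨d₂, e₂⟩ := mem_kernel_iff.1 h₂
  rw [h.kernel_eq, ← h'.kernel_eq] at h₂
  obtain ⟨d₂', e₂'⟩ := mem_kernel_iff.1 h₂
  have a := S.map_add ⟨T g, d⟩ ⟨f₂, d₂⟩
  have a' := S'.map_add ⟨T g, d'⟩ ⟨f₂, d₂'⟩
  rw [AddMemClass.mk_add_mk, e, e₂] at a
  rw [AddMemClass.mk_add_mk, e', e₂'] at a'
  exact a.trans a'.symm

theorem unique (h : IsReciprocal T S) (h' : IsReciprocal T S') : S = S' :=
  le_antisymm (h.le h') (h'.le h)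

end IsReciprocal

theorem sup_zero_toPMap_of_mem_left {A : H →ₗ.[ℂ] H} {R : Submodule ℂ H}
    (hdisj : Disjoint A.domain ((0 : H →ₗ[ℂ] H).toPMap R).domain) (x : A.domain) :
    ∃ h, A.sup ((0 : H →ₗ[ℂ] H).toPMap R) (LinearPMap.sup_h_of_disjoint _ _ hdisj) ⟨x, h⟩ = A x := by
  have hle := LinearPMap.left_le_sup A _ (LinearPMap.sup_h_of_disjoint _ _ hdisj)
  exact ⟨hle.1 x.2, (hle.2 rfl).symm⟩

theorem sup_zero_toPMap_of_mem_right {A : H →ₗ.[ℂ] H} {R : Submodule ℂ H}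
    (hdisj : Disjoint A.domain ((0 : H →ₗ[ℂ] H).toPMap R).domain) {x : H} (hx : x ∈ R) :
    ∃ h, A.sup ((0 : H →ₗ[ℂ] H).toPMap R) (LinearPMap.sup_h_of_disjoint _ _ hdisj) ⟨x, h⟩ = 0 := by
  have hle := LinearPMap.right_le_sup A _ (LinearPMap.sup_h_of_disjoint _ _ hdisj)
  exact ⟨hle.1 hx, (hle.2 (x := ⟨x, hx⟩) rfl).symm⟩

theorem Decomposable.exists_isReciprocal [CompleteSpace H] {T : H →ₗ.[ℂ] H}
    (hT : Decomposable T) : ∃ S, IsReciprocal T S := by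
  let T₀ := T.domRestrict (kernel T)ᗮ
  have hT₀ : ∀ (x : T₀.domain) (hx : (x : H) ∈ T.domain), T₀ x = T ⟨x, hx⟩ := fun x hx =>
    LinearPMap.domRestrict_apply (y := ⟨(x : H), hx⟩) rfl
  -- `LinearPMap.inverse` has the expected values only when the kernel is trivial.
  have hker : LinearMap.ker T₀.toFun = ⊥ := by
    rw [LinearMap.ker_eq_bot']
    intro x hx
    have hx0 : (x : H) ∈ kernel T := mem_kernel_iff.2 ⟨x.2.2, (hT₀ x x.2.2).symm.trans hx⟩
    have : (x : H) ∈ kernel T ⊓ (kernel T)ᗮ := ⟨hx0, x.2.1⟩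
    rw [Submodule.inf_orthogonal_eq_bot, Submodule.mem_bot] at this
    exact Subtype.ext this
  have hdom : T₀.inverse.domain = range T := by
    rw [LinearPMap.inverse_domain]
    ext y
    constructor
    · rintro ⟨x, rfl⟩
      exact ⟨⟨x, x.2.2⟩, (hT₀ x x.2.2).symm⟩
    · rintro ⟨x, rfl⟩
      obtain ⟨g, hg, hTg, -⟩ := hT.exists_orthogonal x
      exact ⟨⟨g, hg, g.2⟩, (hT₀ _ g.2).trans hTg⟩
  have hdisj : Disjoint T₀.inverse.domain ((0 : H →ₗ[ℂ] H).toPMap (range T)ᗮ).domain := by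
    rw [hdom]
    exact (range T).orthogonal_disjoint
  refine ⟨_, isReciprocal_of_decomposable hT
    (S := T₀.inverse.sup _ (LinearPMap.sup_h_of_disjoint _ _ hdisj)) ?_ ?_ ?_⟩
  · rw [LinearPMap.domain_sup, hdom, LinearMap.toPMap_domain]
  · intro g hg
    have hy : T g ∈ T₀.inverse.domain := by
      rw [hdom]
      exact apply_mem_range T g
    obtain ⟨h, e⟩ := sup_zero_toPMap_of_mem_left hdisj ⟨T g, hy⟩
    exact ⟨h, e.trans (LinearPMap.inverse_apply_eq hker (x := ⟨g, hg, g.2⟩) (hT₀ _ g.2))⟩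
  · intro f hf
    exact sup_zero_toPMap_of_mem_right hdisj hf

theorem Decomposable.existsUnique_isReciprocal [CompleteSpace H] {T : H →ₗ.[ℂ] H}
    (hT : Decomposable T) : ∃! S, IsReciprocal T S := by
  obtain ⟨S, hS⟩ := hT.exists_isReciprocal
  exact ⟨S, hS, fun _ h => h.unique hS⟩

theorem kernel_mono {P T : H →ₗ.[ℂ] H} (hPT : P ≤ T) : kernel P ≤ kernel T := by
  intro f hf
  obtain ⟨h, hf⟩ := mem_kernel_iff.1 hf
  exact mem_kernel_iff.2 ⟨hPT.1 h, (hPT.2 rfl).symm.trans hf⟩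

theorem range_mono {P T : H →ₗ.[ℂ] H} (hPT : P ≤ T) : range P ≤ range T := by
  rintro _ ⟨g, rfl⟩
  exact ⟨⟨g, hPT.1 g.2⟩, (hPT.2 rfl).symm⟩

/-- If the splitting of `D(P)` can be done with vectors orthogonal to the larger kernel `N(T)`,
then the reciprocal of the restriction `P` of `T` is obtained by restricting that of `T`. -/
theorem IsReciprocal.restrictOplusZero [CompleteSpace H] {P T S : H →ₗ.[ℂ] H} (hPT : P ≤ T)
    (hP : ∀ g ∈ P.domain, ∃ n ∈ kernel P, g - n ∈ (kernel T)ᗮ) (hS : IsReciprocal T S) :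
    IsReciprocal P (restrictOplusZero S (range P)) := by
  have hdec : Decomposable P := fun g hg => by
    obtain ⟨n, hn, hgn⟩ := hP g hg
    exact ⟨n, hn, Submodule.orthogonal_le (kernel_mono hPT) hgn⟩
  have hRS : range P ≤ S.domain := by
    rw [hS.domain_eq]
    exact (range_mono hPT).trans le_sup_left
  have hdisj : Disjoint (S.domRestrict (range P)).domain
      ((0 : H →ₗ[ℂ] H).toPMap (range P)ᗮ).domain := by
    rw [LinearPMap.domRestrict_domain]
    exact (range P).orthogonal_disjoint.mono_left inf_le_left
  refine isReciprocal_of_decomposable hdec ?_ ?_ ?_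
  · rw [UnbddOp.restrictOplusZero, LinearPMap.domain_sup, LinearPMap.domRestrict_domain,
      inf_eq_left.2 hRS, LinearMap.toPMap_domain]
  · intro g hg
    obtain ⟨n, hn, hgn⟩ := hP g g.2
    -- Both `g` and `g - n` are orthogonal to `N(P)`, hence so is `n ∈ N(P)`; thus `n = 0`.
    have hgT : (g : H) ∈ (kernel T)ᗮ := by
      have hn' : n ∈ (kernel P)ᗮ := by
        have := Submodule.sub_mem _ hg (Submodule.orthogonal_le (kernel_mono hPT) hgn)
        rwa [sub_sub_cancel] at this
      have hn0 : n ∈ kernel P ⊓ (kernel P)ᗮ := ⟨hn, hn'⟩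
      rw [Submodule.inf_orthogonal_eq_bot, Submodule.mem_bot] at hn0
      simpa [hn0] using hgn
    obtain ⟨d, e⟩ := hS.apply_of_orthogonal ⟨g, hPT.1 g.2⟩ hgT
    have hPg : P g = T ⟨g, hPT.1 g.2⟩ := hPT.2 rfl
    obtain ⟨h, e'⟩ := sup_zero_toPMap_of_mem_left hdisj
      ⟨P g, apply_mem_range P g, hRS (apply_mem_range P g)⟩
    exact ⟨h, e'.trans ((LinearPMap.domRestrict_apply hPg).trans e)⟩
  · intro f hf
    exact sup_zero_toPMap_of_mem_right hdisj hf

end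

end UnbddOp

/-! ### Kernels and domains of weighted composition operators -/

namespace WeightedComp

variable {X : Type*} [MeasurableSpace X]

theorem weightedCompOp_apply_ae {μ : Measure X} {φ : X → X} {w : X → ℂ} (h : WellDefined μ φ w)
    (f : (weightedCompOp μ φ w h).domain) :
    weightedCompOp μ φ w h f =ᵐ[μ] fun x => w x * (f : Lp ℂ 2 μ) (φ x) :=
  MemLp.coeFn_toLp (memLp_of_mem (h := h) f.2)

theorem mem_kernel_weightedCompOp_iff {μ : Measure X} {φ : X → X} {w : X → ℂ}
    (h : WellDefined μ φ w) (f : Lp ℂ 2 μ) :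
    f ∈ UnbddOp.kernel (weightedCompOp μ φ w h) ↔ (fun x => w x * f (φ x)) =ᵐ[μ] 0 := by
  have key : ∀ hf : f ∈ (weightedCompOp μ φ w h).domain,
      weightedCompOp μ φ w h ⟨f, hf⟩ = 0 ↔ (fun x => w x * f (φ x)) =ᵐ[μ] 0 := fun hf => by
    have e := weightedCompOp_apply_ae h ⟨f, hf⟩
    rw [Lp.eq_zero_iff_ae_eq_zero]
    exact ⟨e.symm.trans, e.trans⟩
  rw [UnbddOp.mem_kernel_iff]
  constructor
  · rintro ⟨hf, hf0⟩
    exact (key hf).1 hf0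
  · intro hf0
    have hf : f ∈ (weightedCompOp μ φ w h).domain := (memLp_congr_ae hf0).2 MemLp.zero
    exact ⟨hf, (key hf).2 hf0⟩

/-- With this form of the domain, invariance under a cut-off can be checked one weight at a time. -/
theorem mem_domain_prod_iff {μ : Measure X} {φ : X → X} (w : X → ℂ) (hC : WellDefined μ φ 1)
    (f : Lp ℂ 2 μ) :
    f ∈ (UnbddOp.prod (mulOp μ w) (compOp μ φ hC)).domain ↔
      f ∈ weightedCompDomain μ φ 1 hC ∧ f ∈ weightedCompDomain μ φ w (hC.weight w) := by
  have key : ∀ hf : f ∈ (compOp μ φ hC).domain,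
      (fun x => w x * (compOp μ φ hC ⟨f, hf⟩ : Lp ℂ 2 μ) x) =ᵐ[μ] fun x => w x * f (φ x) := by
    intro hf
    filter_upwards [weightedCompOp_apply_ae hC ⟨f, hf⟩] with x hx
    refine congrArg (w x * ·) (hx.trans ?_)
    simp
  exact ⟨fun ⟨hf, hf'⟩ => ⟨hf, (memLp_congr_ae (key hf)).1 hf'⟩,
    fun ⟨hf, hf'⟩ => ⟨hf, (memLp_congr_ae (key hf)).2 hf'⟩⟩

theorem prod_le {μ : Measure X} {φ : X → X} (w : X → ℂ) (hC : WellDefined μ φ 1) :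
    UnbddOp.prod (mulOp μ w) (compOp μ φ hC) ≤ weightedCompOp μ φ w (hC.weight w) := by
  refine ⟨fun f hf => ((mem_domain_prod_iff w hC f).1 hf).2, ?_⟩
  rintro ⟨f, hf⟩ ⟨f', hf'⟩ (rfl : f = f')
  refine MemLp.toLp_congr (memLp_of_mem (h := wellDefined_id μ w) hf.2)
    (memLp_of_mem (h := hC.weight w) hf') ?_
  filter_upwards [weightedCompOp_apply_ae hC ⟨f, hf.1⟩] with x hx
  refine congrArg (w x * ·) (hx.trans ?_)
  simp

/-- A measurable set carrying `μ_w ∘ φ⁻¹`, on which `μ` is absolutely continuous with respect to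
`μ_w ∘ φ⁻¹`. -/
theorem exists_carrier {μ : Measure X} [SigmaFinite μ] {φ : X → X} (hφ : Measurable φ) {w : X → ℂ}
    (hw : Measurable w) (h : WellDefined μ φ w) :
    ∃ A : Set X, MeasurableSet A ∧ (∀ᵐ x ∂μ, φ x ∉ A → w x = 0) ∧
      ∀ f : X → ℂ, Measurable f → (fun x => w x * f (φ x)) =ᵐ[μ] 0 → ∀ᵐ x ∂μ, x ∈ A → f x = 0 := by
  have hd : Measurable fun x => ‖w x‖ₑ ^ 2 := hw.enorm.pow_const 2
  set ν := (μ.withDensity fun x => ‖w x‖ₑ ^ 2).map φ with hν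
  have hνμ : ν ≪ μ := (wellDefined_iff hφ hw).1 h
  have hnull : ∀ N, MeasurableSet N → (ν N = 0 ↔ ∀ᵐ x ∂μ, φ x ∈ N → w x = 0) := by
    intro N hN
    rw [hν, Measure.map_apply hφ hN, withDensity_apply _ (hφ hN),
      setLIntegral_eq_zero_iff (hφ hN) hd]
    simp
  have hr : Measurable (ν.rnDeriv μ) := Measure.measurable_rnDeriv ν μ
  have hnull' : ∀ N, MeasurableSet N → (ν N = 0 ↔ ∀ᵐ x ∂μ, x ∈ N → ν.rnDeriv μ x = 0) := by
    intro N hN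
    -- `ν` need not be σ-finite, so the density may be infinite; only its zero set matters.
    conv_lhs => rw [← Measure.withDensity_rnDeriv_eq ν μ hνμ]
    rw [withDensity_apply _ hN, setLIntegral_eq_zero_iff hN hr]
  have hA : MeasurableSet {x | ν.rnDeriv μ x ≠ 0} := (hr (measurableSet_singleton 0)).compl
  refine ⟨{x | ν.rnDeriv μ x ≠ 0}, hA, ?_, fun f hf hf0 => ?_⟩
  · refine (hnull _ hA.compl).1 ((hnull' _ hA.compl).2 (ae_of_all _ fun x hx => ?_))
    simpa using hx
  · have hN : MeasurableSet {x | f x ≠ 0} := (hf (measurableSet_singleton 0)).compl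
    have : ν {x | f x ≠ 0} = 0 := by
      refine (hnull _ hN).2 ?_
      filter_upwards [hf0] with x hx hxN
      exact (mul_eq_zero.1 hx).resolve_right hxN
    filter_upwards [(hnull' _ hN).1 this] with x hx hxA
    by_contra hfx
    exact hxA (hx hfx)

/-- Cutting off a function outside a carrier of `μ_w ∘ φ⁻¹` splits it into a part orthogonal to
`N(C_{φ,w})` and a part in `N(C_{φ,w})`. The cut-off preserves the domain of every `C_{φ,v}`. -/
theorem exists_mem_kernel_sub_mem_orthogonal {μ : Measure X} [SigmaFinite μ] {φ : X → X}
    (hφ : Measurable φ) {w : X → ℂ} (hw : Measurable w) (hC : WellDefined μ φ 1) (f : Lp ℂ 2 μ) :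
    ∃ n ∈ UnbddOp.kernel (weightedCompOp μ φ w (hC.weight w)),
      f - n ∈ (UnbddOp.kernel (weightedCompOp μ φ w (hC.weight w)))ᗮ ∧
      ∀ v : X → ℂ, f ∈ weightedCompDomain μ φ v (hC.weight v) →
        n ∈ weightedCompDomain μ φ v (hC.weight v) := by
  obtain ⟨A, hA, hA0, hA1⟩ := exists_carrier hφ hw (hC.weight w)
  have hfm : Measurable f := (Lp.stronglyMeasurable f).measurable
  have hmem : MemLp (Aᶜ.indicator f) 2 μ := (Lp.memLp f).indicator hA.compl
  have hm : Measurable (Aᶜ.indicator f) := hfm.indicator hA.compl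
  set n : Lp ℂ 2 μ := hmem.toLp _ with hn
  have hnae : n =ᵐ[μ] Aᶜ.indicator f := hmem.coeFn_toLp
  -- `n` is the cut-off only up to a null set, so well-definedness is what allows composing with
  -- `φ`.
  have hcomp : ∀ v : X → ℂ,
      (fun x => v x * n (φ x)) =ᵐ[μ] fun x => v x * Aᶜ.indicator f (φ x) := fun v =>
    hC.weight v _ _ (Lp.stronglyMeasurable n).measurable hm (Lp.memLp n) hmem hnae
  have hzero : (fun x => w x * n (φ x)) =ᵐ[μ] 0 := by
    filter_upwards [hcomp w, hA0] with x hx hxA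
    rw [hx]
    by_cases hxA' : φ x ∈ A
    · simp [hxA']
    · simp [hxA hxA']
  refine ⟨n, (mem_kernel_weightedCompOp_iff _ n).2 hzero, ?_, ?_⟩
  · rw [Submodule.mem_orthogonal]
    intro k hk
    have hk' := (mem_kernel_weightedCompOp_iff _ k).1 hk
    rw [L2.inner_def]
    refine integral_eq_zero_of_ae ?_
    -- `k` vanishes on `A` and `f - n` off `A`, so the integrand is zero a.e.
    filter_upwards [hA1 k (Lp.stronglyMeasurable k).measurable hk', Lp.coeFn_sub f n, hnae]
      with x hx hs hnx
    by_cases hxA : x ∈ A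
    · simp [hx hxA]
    · rw [hs, Pi.sub_apply, hnx]
      simp [hxA]
  · intro v hf
    refine (memLp_congr_ae (hcomp v)).2 ?_
    have : (fun x => v x * Aᶜ.indicator f (φ x)) =
        (φ ⁻¹' Aᶜ).indicator fun x => v x * f (φ x) := by
      ext x
      by_cases hx : φ x ∈ A <;> simp [Set.indicator, hx]
    rw [this]
    exact (memLp_of_mem hf).indicator (hφ hA.compl)

theorem decomposable_weightedCompOp {μ : Measure X} [SigmaFinite μ] {φ : X → X}
    (hφ : Measurable φ) {w : X → ℂ} (hw : Measurable w) (hC : WellDefined μ φ 1) :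
    UnbddOp.Decomposable (weightedCompOp μ φ w (hC.weight w)) := fun f _ => by
  obtain ⟨n, hn, hfn, -⟩ := exists_mem_kernel_sub_mem_orthogonal hφ hw hC f
  exact ⟨n, hn, hfn⟩

/-- The cut-off of `f` stays in `D(C_φ)` (the weight `v = 1`) and lies in `N(C_{φ,w})`, hence in the
kernel of the product. -/
theorem exists_mem_kernel_prod {μ : Measure X} [SigmaFinite μ] {φ : X → X}
    (hφ : Measurable φ) {w : X → ℂ} (hw : Measurable w) (hC : WellDefined μ φ 1) {f : Lp ℂ 2 μ}
    (hf : f ∈ (UnbddOp.prod (mulOp μ w) (compOp μ φ hC)).domain) :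
    ∃ n ∈ UnbddOp.kernel (UnbddOp.prod (mulOp μ w) (compOp μ φ hC)),
      f - n ∈ (UnbddOp.kernel (weightedCompOp μ φ w (hC.weight w)))ᗮ := by
  obtain ⟨n, hn, hfn, hdom⟩ := exists_mem_kernel_sub_mem_orthogonal hφ hw hC f
  obtain ⟨hnd, hn0⟩ := UnbddOp.mem_kernel_iff.1 hn
  have hnP := (mem_domain_prod_iff w hC n).2
    ⟨hdom 1 ((mem_domain_prod_iff w hC f).1 hf).1, hnd⟩
  exact ⟨n, UnbddOp.mem_kernel_iff.2 ⟨hnP, ((prod_le w hC).2 rfl).trans hn0⟩, hfn⟩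

end WeightedComp

theorem proposition16 {X : Type*} [MeasurableSpace X] (μ : Measure X) [SigmaFinite μ]
    (φ : X → X) (hφ : Measurable φ) (w : X → ℂ) (hw : Measurable w)
    (hC : WeightedComp.WellDefined μ φ 1) :
    (∃! S, UnbddOp.IsReciprocal (WeightedComp.weightedCompOp μ φ w (hC.weight w)) S) ∧
    (∃! R, UnbddOp.IsReciprocal
      (UnbddOp.prod (WeightedComp.mulOp μ w) (WeightedComp.compOp μ φ hC)) R) ∧
    ∀ S R : Lp ℂ 2 μ →ₗ.[ℂ] Lp ℂ 2 μ,
      UnbddOp.IsReciprocal (WeightedComp.weightedCompOp μ φ w (hC.weight w)) S →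
      UnbddOp.IsReciprocal
        (UnbddOp.prod (WeightedComp.mulOp μ w) (WeightedComp.compOp μ φ hC)) R →
      R = UnbddOp.restrictOplusZero S
        (UnbddOp.range (UnbddOp.prod (WeightedComp.mulOp μ w) (WeightedComp.compOp μ φ hC))) := by
  have hdec := WeightedComp.decomposable_weightedCompOp hφ hw hC
  -- This yields both the existence of a reciprocal of the product and, by uniqueness, the formula.
  have hrec := fun S (hS : UnbddOp.IsReciprocal
      (WeightedComp.weightedCompOp μ φ w (hC.weight w)) S) =>
    hS.restrictOplusZero (WeightedComp.prod_le w hC)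
      fun _ hf => WeightedComp.exists_mem_kernel_prod hφ hw hC hf
  refine ⟨hdec.existsUnique_isReciprocal, ?_, fun S R hS hR => hR.unique (hrec S hS)⟩
  obtain ⟨S, hS⟩ := hdec.exists_isReciprocal
  exact ⟨_, hrec S hS, fun R hR => hR.unique (hrec S hS)⟩
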